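/- All graphs are finite and simple. For a graph $G$ with vertex set $V$, its chromatic symmetric function is the formal power series $X_G=\sum_{\kappa}\prod_{v\in V}x_{\kappa(v)}\in\mathbb{Q}[[x_1,x_2,\ldots]]$, where the sum is over all proper colourings of $G$, that is, all maps $\kappa:V\to\{1,2,\ldots\}$ with $\kappa(v)\ne\kappa(w)$ whenever $v$ and $w$ are adjacent. For $i\ge 1$ let $e_i=\sum_{j_1<\cdots<j_i}x_{j_1}\cdots x_{j_i}$, and for a partition $\lambda=(\lambda_1,\ldots,\lambda_\ell)$ let $e_\lambda=e_{\lambda_1}\cdots e_{\lambda_\ell}$. The graph $G$ is called $e$-positive if $X_G$ is a linear combination of the $e_\lambda$ with nonnegative coefficients. A cut vertex of a connected graph is a vertex whose deletion, together with its incident edges, yields a graph with more than one connected component. **Theorem.** Let $G$ be an $n$-vertex connected graph with a cut vertex whose deletion produces a graph with $d\ge 3$ connected components, where $d\ge\log_2 n+1$. Then $G$ is not $e$-positive. In particular, if $T$ is an $n$-vertex tree with a vertex of degree $d\ge 3$, where $d\ge\log_2 n+1$, then $T$ is not $e$-positive. -/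

import Mathlib

/-- The monomial `∏ v, x_{κ v}` attached to a map `κ` from a finite type to the indices of the
variables `x₀, x₁, x₂, …`, recorded by its exponent vector. -/
noncomputable def colouringExponent {V : Type*} [Fintype V] (κ : V → ℕ) : ℕ →₀ ℕ :=
  ∑ v, Finsupp.single (κ v) 1

/-- Only finitely many maps `κ` yield a given monomial, so that the number of them is meaningful. -/
theorem finite_colouringExponent_eq {V : Type*} [Fintype V] (m : ℕ →₀ ℕ) :
    {κ : V → ℕ | colouringExponent κ = m}.Finite := by
  refine (Set.Finite.pi' (fun _ : V => m.support.finite_toSet)).subset ?_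
  intro κ hκ v
  have hκ' : colouringExponent κ = m := hκ
  have h : colouringExponent κ (κ v) ≠ 0 := by
    rw [colouringExponent, Finsupp.finsetSum_apply]
    have : Finsupp.single (κ v) 1 (κ v) ≤ ∑ w, (Finsupp.single (κ w) 1 : ℕ →₀ ℕ) (κ v) :=
      Finset.single_le_sum (f := fun w => (Finsupp.single (κ w) 1 : ℕ →₀ ℕ) (κ v))
        (fun _ _ => Nat.zero_le _) (Finset.mem_univ v)
    simp only [Finsupp.single_eq_same] at this
    omega
  rw [hκ'] at h
  simpa using h

/-- The chromatic symmetric function `X_G = ∑_κ ∏_v x_{κ v}`, the sum over all proper colourings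
`κ` of the finite graph `G` with colours in a countably infinite set, as a formal power series in
the variables `x₀, x₁, x₂, …` over `ℚ`: the coefficient of a monomial is the number of proper
colourings which yield that monomial. -/
noncomputable def chromaticSymmetricFunction {V : Type*} [Fintype V] (G : SimpleGraph V) :
    MvPowerSeries ℕ ℚ :=
  fun m => ({κ : V → ℕ | (∀ v w, G.Adj v w → κ v ≠ κ w) ∧ colouringExponent κ = m}.ncard : ℚ)

/-- The `k`-th elementary symmetric function `e_k = ∑_{j₁ < ⋯ < j_k} x_{j₁} ⋯ x_{j_k}`: the
coefficient of a monomial is `1` if it is a product of `k` distinct variables and `0` otherwise. -/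
noncomputable def elementarySymmetric (k : ℕ) : MvPowerSeries ℕ ℚ :=
  open Classical in
  fun m => if ∃ s : Finset ℕ, s.card = k ∧ m = ∑ j ∈ s, Finsupp.single j 1 then 1 else 0

/-- The elementary symmetric function `e_λ = ∏ e_{λ_i}` of a partition `λ`. -/
noncomputable def elementarySymmetricPart {N : ℕ} (lam : N.Partition) : MvPowerSeries ℕ ℚ :=
  (lam.parts.map elementarySymmetric).prod

/-- A power series is `e`-positive if it is a (finite) linear combination with nonnegative
coefficients of the `e_λ`, where `λ` ranges over the partitions of all natural numbers. -/
def IsEPositive (f : MvPowerSeries ℕ ℚ) : Prop :=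
  ∃ c : (Σ N : ℕ, N.Partition) →₀ ℚ,
    (∀ p, 0 ≤ c p) ∧ f = c.sum (fun p a => a • elementarySymmetricPart p.2)

/-- A graph is `e`-positive if its chromatic symmetric function is. -/
def SimpleGraph.IsEPositive {V : Type*} [Fintype V] (G : SimpleGraph V) : Prop :=
  _root_.IsEPositive (chromaticSymmetricFunction G)

/-- The graph obtained from `G` by deleting the vertex `v` and its incident edges. -/
abbrev SimpleGraph.deleteVertex {V : Type*} (G : SimpleGraph V) (v : V) :
    SimpleGraph {w : V // w ≠ v} :=
  G.induce {w : V | w ≠ v}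

/-- A cut vertex of a connected graph: its deletion yields a graph with more than one connected
component. -/
def SimpleGraph.IsCutVertex {V : Type*} (G : SimpleGraph V) (v : V) : Prop :=
  G.Connected ∧ 1 < Nat.card (G.deleteVertex v).ConnectedComponent

/-! An `e`-positive connected graph on `n` vertices has a partition into connected blocks of any
prescribed positive sizes `m i` with sum `n` (`exists_connected_partition`). To see this, substitute
`θ i * z * X_i` for the variables, with `z` running over the `m i`-th roots of unity and `θ i`
fixing a sign. Each `e_k` becomes the sum of `∏ i ∈ J, X_i ^ m i` over the `J` with `∑ i ∈ J, m i =
k`. So every `e_λ` acquires nonnegative integer coefficients, and `e_n` contains the full monomial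
`∏ i, X_i ^ m i`. The coefficient of `e_n` in `X_G` is nonzero because `G` is connected, hence
positive, and the full monomial survives in the image of `X_G`. Its coefficient there is a sum over
block maps `V → τ`, and rotating the colours on part of a disconnected block shows that only maps
with connected blocks contribute.

Now take blocks of size `m` and one of size at most `m`. A block avoiding the cut vertex lies in one
component of `G - v`. Hence the residues modulo `m` of the component sizes, one component excepted,
sum to less than `m` (`exists_sum_residues_lt`). With `m` one more than the largest size in a family
of components, that size is at least the sum of the others. Totals therefore double with each
component, and `2 ^ (d - 1) ≤ n - 1`, contrary to `d ≥ log₂ n + 1`. -/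

noncomputable instance fintypeRootsOfUnityComplex (m : ℕ) [NeZero m] :
    Fintype (rootsOfUnity m ℂ) :=
  Fintype.ofFinite _

/-! ### Specialising symmetric functions to finitely many variables. -/

/-- The power series counting the objects `x` with `P x` by their exponent vector `ex x`. -/
noncomputable def countingSeries {α : Type*} (P : α → Prop) (ex : α → ℕ →₀ ℕ) :
    MvPowerSeries ℕ ℚ :=
  fun d => ({x | P x ∧ ex x = d}.ncard : ℚ)

open MvPowerSeries in
-- Both `e_k` and `X_G` count objects by exponent vector, so this single computation evaluates the
-- substitution in both.
theorem subst_countingSeries {α τ : Type*} (P : α → Prop) (ex : α → ℕ →₀ ℕ)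
    (b : ℕ → MvPowerSeries τ ℂ) (hb : HasSubst b)
    (F : Finset α) (hFP : ∀ x ∈ F, P x)
    (hF : ∀ x, P x → x ∉ F → (ex x).prod (fun s e => b s ^ e) = 0) :
    subst b (countingSeries P ex) =
      ∑ x ∈ F, (ex x).prod (fun s e => b s ^ e) := by
  classical
  ext e
  rw [coeff_subst hb, map_sum]
  have key : ∀ d : ℕ →₀ ℕ,
      coeff d (countingSeries P ex) •
        coeff e (d.prod fun s e => b s ^ e) =
      ∑ x ∈ F with ex x = d, coeff e ((ex x).prod (fun s e => b s ^ e)) := by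
    intro d
    rw [Finset.sum_congr rfl (g := fun _ => coeff e (d.prod fun s e => b s ^ e))
      (fun x hx => by rw [(Finset.mem_filter.1 hx).2]), Finset.sum_const]
    -- If the monomial does not vanish under `b`, every object with this exponent vector lies in
    -- `F`, so `ncard` counts a finite set.
    by_cases h0 : d.prod (fun s e => b s ^ e) = 0
    · simp [h0]
    · have : {x | P x ∧ ex x = d} = ((F.filter fun x => ex x = d : Finset α) : Set α) := by
        ext x
        simp only [Set.mem_ofPred_eq, Finset.coe_filter]
        constructor
        · rintro ⟨h1, h2⟩
          refine ⟨?_, h2⟩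
          by_contra h3
          exact h0 (h2 ▸ hF x h1 h3)
        · rintro ⟨h1, h2⟩
          exact ⟨hFP x h1, h2⟩
      change (({x | P x ∧ ex x = d}.ncard : ℚ)) • _ = _
      rw [this, Set.ncard_coe_finset, Nat.cast_smul_eq_nsmul]
  rw [finsum_congr key, finsum_eq_sum_of_support_subset (s := F.image ex)]
  · exact Finset.sum_fiberwise_of_maps_to (fun x hx => Finset.mem_image_of_mem _ hx) _
  · intro d hd
    obtain ⟨x, hx, -⟩ := Finset.exists_ne_zero_of_sum_ne_zero hd
    rw [Finset.mem_filter] at hx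
    exact Finset.mem_coe.2 (Finset.mem_image.2 ⟨x, hx⟩)

theorem prod_pow_sum_single {ι R : Type*} [CommSemiring R] (s : Finset ι) (f : ι → ℕ)
    (b : ℕ → R) :
    (∑ i ∈ s, Finsupp.single (f i) 1 : ℕ →₀ ℕ).prod (fun j e => b j ^ e) = ∏ i ∈ s, b (f i) := by
  rw [← Finsupp.prod_finsetSum_index (by simp) (by intros; rw [pow_add])]
  simp

theorem sum_single_one_injective :
    Function.Injective fun s : Finset ℕ => (∑ j ∈ s, Finsupp.single j 1 : ℕ →₀ ℕ) := by
  intro s t h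
  ext j
  have := DFunLike.congr_fun h j
  simp only [Finsupp.finsetSum_apply, Finsupp.single_apply, Finset.sum_ite_eq'] at this
  by_cases h1 : j ∈ s <;> by_cases h2 : j ∈ t <;> simp_all

open Classical in
/-- Specialising the variables `x₀, x₁, …` to finitely many power series `a i` (and `0`). -/
theorem exists_specialization {V I τ : Type*} [Fintype V] [Fintype I] (G : SimpleGraph V)
    (a : I → MvPowerSeries τ ℂ) (ha : ∀ i, MvPowerSeries.constantCoeff (a i) = 0) :
    ∃ Φ : MvPowerSeries ℕ ℚ →ₐ[ℚ] MvPowerSeries τ ℂ,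
      (∀ k, Φ (elementarySymmetric k) = ∑ s ∈ Finset.univ.powersetCard k, ∏ i ∈ s, a i) ∧
      Φ (chromaticSymmetricFunction G) =
        ∑ κ : V → I with ∀ v w, G.Adj v w → κ v ≠ κ w, ∏ v, a (κ v) := by
  obtain ⟨g, hg⟩ : ∃ g : I → ℕ, Function.Injective g :=
    ⟨fun i => Fintype.equivFin I i, Fin.val_injective.comp (Fintype.equivFin I).injective⟩
  set b : ℕ → MvPowerSeries τ ℂ := Function.extend g a 0 with hbdef
  have hbg : ∀ i, b (g i) = a i := fun i => hg.extend_apply a 0 i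
  have hb0 : ∀ k, k ∉ Set.range g → b k = 0 := fun k hk => by
    rw [hbdef, Function.extend_apply' _ _ _ (by simpa using hk)]; rfl
  have hb : MvPowerSeries.HasSubst b := by
    constructor
    · intro k
      by_cases hk : k ∈ Set.range g
      · obtain ⟨i, rfl⟩ := hk
        rw [hbg, ha]; exact IsNilpotent.zero
      · rw [hb0 k hk, map_zero]; exact IsNilpotent.zero
    · intro d
      refine (Set.finite_range g).subset ?_
      intro k hk
      by_contra h
      exact hk (by rw [hb0 k h, map_zero])
  refine ⟨MvPowerSeries.substAlgHom hb, ?_, ?_⟩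
  · intro k
    have h1 : elementarySymmetric k = countingSeries (fun s : Finset ℕ => s.card = k)
        (fun s => ∑ j ∈ s, Finsupp.single j 1) := by
      funext d
      unfold elementarySymmetric countingSeries
      split_ifs with h
      · obtain ⟨s, hs, rfl⟩ := h
        have : {t : Finset ℕ | t.card = k ∧ (∑ j ∈ t, Finsupp.single j 1 : ℕ →₀ ℕ) =
            ∑ j ∈ s, Finsupp.single j 1} = {s} := by
          ext t
          constructor
          · rintro ⟨-, h⟩
            exact sum_single_one_injective h
          · rintro rfl
            exact ⟨hs, rfl⟩
        rw [this]; simp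
      · have : {t : Finset ℕ | t.card = k ∧ (∑ j ∈ t, Finsupp.single j 1 : ℕ →₀ ℕ) = d} = ∅ := by
          ext t
          simp only [Set.mem_ofPred_eq, Set.mem_empty_iff_false, iff_false]
          rintro ⟨h1, h2⟩
          exact h ⟨t, h1, h2.symm⟩
        rw [this]; simp
    rw [MvPowerSeries.coe_substAlgHom, h1, subst_countingSeries _ _ b hb
      ((Finset.univ.powersetCard k).map (Finset.mapEmbedding ⟨g, hg⟩).toEmbedding)]
    · rw [Finset.sum_map]
      refine Finset.sum_congr rfl fun s _ => ?_
      rw [prod_pow_sum_single _ (fun j => j)]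
      simp [hbg]
    · intro s hs
      rw [Finset.mem_map] at hs
      obtain ⟨t, ht, rfl⟩ := hs
      simpa using ht
    · intro s hs hns
      rw [prod_pow_sum_single _ (fun j => j)]
      by_contra h0
      apply hns
      have : ∀ j ∈ s, j ∈ Set.range g := fun j hj => by
        by_contra h
        exact h0 (Finset.prod_eq_zero hj (hb0 j h))
      obtain ⟨t, rfl⟩ : ∃ t : Finset I, t.map ⟨g, hg⟩ = s := by
        obtain ⟨t, -, ht⟩ := Finset.subset_map_iff (t := (Finset.univ : Finset I))
          (f := ⟨g, hg⟩) (s := s) |>.1 (fun j hj => by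
            obtain ⟨i, rfl⟩ := this j hj
            simp)
        exact ⟨t, ht.symm⟩
      rw [Finset.mem_map]
      exact ⟨t, by simpa using hs, rfl⟩
  · rw [MvPowerSeries.coe_substAlgHom]
    have h1 : chromaticSymmetricFunction G = countingSeries
      (fun κ : V → ℕ => ∀ v w, G.Adj v w → κ v ≠ κ w) colouringExponent := rfl
    rw [h1, subst_countingSeries _ _ b hb
      ((Finset.univ.filter fun κ : V → I => ∀ v w, G.Adj v w → κ v ≠ κ w).image (g ∘ ·))]
    · rw [Finset.sum_image (fun κ _ κ' _ h => hg.comp_left h)]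
      refine Finset.sum_congr rfl fun κ _ => ?_
      rw [colouringExponent, prod_pow_sum_single]
      simp [hbg]
    · intro κ hκ
      simp only [Finset.mem_image, Finset.mem_filter, Finset.mem_univ, true_and] at hκ
      obtain ⟨κ, h, rfl⟩ := hκ
      exact fun v w hvw heq => h v w hvw (hg heq)
    · intro κ hκ hn
      rw [colouringExponent, prod_pow_sum_single]
      by_contra h0
      apply hn
      have : ∀ v, ∃ i, g i = κ v := fun v => by
        by_contra h
        exact h0 (Finset.prod_eq_zero (Finset.mem_univ v) (hb0 _ h))
      choose κ' hκ' using this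
      simp only [Finset.mem_image, Finset.mem_filter, Finset.mem_univ, true_and]
      refine ⟨κ', fun v w hvw heq => hκ v w hvw ?_, funext hκ'⟩
      rw [← hκ', ← hκ', heq]

/-! ### Specialisation at roots of unity. -/

/-- Factor `1 - w ^ m` over the roots of unity at `w = -θ y`; the choice of `θ ^ m` turns the sign
into `+`. Checked on complex numbers, the identity holds for polynomials and so in every
`ℂ`-algebra. -/
theorem prod_rootsOfUnity_one_add (m : ℕ) [NeZero m] (θ : ℂ) {A : Type*} [CommRing A] [Algebra ℂ A]
    (hθ : θ ^ m = (-1) ^ (m - 1)) (y : A) :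
    ∏ z : rootsOfUnity m ℂ, (1 + algebraMap ℂ A (θ * ((z : ℂˣ) : ℂ)) * y) = 1 + y ^ m := by
  have hm : 0 < m := Nat.pos_of_ne_zero (NeZero.ne m)
  have hsc : ∀ t : ℂ, ∏ z : rootsOfUnity m ℂ, (1 + θ * ((z : ℂˣ) : ℂ) * t) = 1 + t ^ m := by
    intro t
    have h := (Complex.isPrimitiveRoot_exp m hm.ne').pow_sub_pow_eq_prod_sub_mul 1 (-(θ * t)) hm
    have h2 : (1 : ℂ) ^ m - (-(θ * t)) ^ m = 1 + t ^ m := by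
      rw [neg_pow, mul_pow, hθ, one_pow, ← mul_assoc, ← pow_add]
      have : Odd (m + (m - 1)) := ⟨m - 1, by omega⟩
      rw [this.neg_one_pow]; ring
    rw [← h2, h]
    refine Finset.prod_bij (fun z _ => ((z : ℂˣ) : ℂ)) ?_ ?_ ?_ ?_
    · intro z _
      rw [Polynomial.mem_nthRootsFinset hm, ← mem_rootsOfUnity']
      exact z.2
    · intro z _ w _ h
      exact Subtype.ext (Units.ext h)
    · intro z hz
      rw [Polynomial.mem_nthRootsFinset hm] at hz
      exact ⟨rootsOfUnity.mkOfPowEq z hz, Finset.mem_univ _, rfl⟩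
    · intro z _
      ring
  have hpoly : ∏ z : rootsOfUnity m ℂ,
      (1 + Polynomial.C (θ * ((z : ℂˣ) : ℂ)) * Polynomial.X) = 1 + Polynomial.X ^ m := by
    refine Polynomial.funext fun t => ?_
    simp only [Polynomial.eval_prod, Polynomial.eval_add, Polynomial.eval_one, Polynomial.eval_mul,
      Polynomial.eval_C, Polynomial.eval_X, Polynomial.eval_pow]
    exact hsc t
  have := congrArg (Polynomial.aeval y) hpoly
  simpa using this

/-- Colours indexed by a block `i` and an `m i`-th root of unity. -/
abbrev RootColour {τ : Type*} (m : τ → ℕ) : Type _ := Σ i : τ, rootsOfUnity (m i) ℂ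

/-- The monomial to which a colour specialises. -/
noncomputable def rootWeight {τ : Type*} (m : τ → ℕ) (θ : τ → ℂ) (c : RootColour m) :
    MvPowerSeries τ ℂ :=
  MvPowerSeries.monomial (Finsupp.single c.1 1) (θ c.1 * ((c.2 : ℂˣ) : ℂ))

-- Compare coefficients in the generating function `∏ (1 + x t)` of the `e_k`, which collapses block
-- by block to `∏ i, (1 + (X_i t) ^ m i)`.
open Polynomial in
theorem sum_prod_rootWeight {τ : Type*} [Fintype τ] (m : τ → ℕ) [∀ i, NeZero (m i)] (θ : τ → ℂ)
    (hθ : ∀ i, θ i ^ m i = (-1) ^ (m i - 1)) (k : ℕ) :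
    ∑ s ∈ (Finset.univ : Finset (RootColour m)).powersetCard k, ∏ c ∈ s, rootWeight m θ c =
      ∑ J : Finset τ with ∑ i ∈ J, m i = k,
        MvPowerSeries.monomial (∑ i ∈ J, Finsupp.single i (m i)) (1 : ℂ) := by
  classical
  have h1 : ∏ c : RootColour m, (1 + C (rootWeight m θ c) * X) =
      ∏ i : τ, (1 + (C (MvPowerSeries.X i : MvPowerSeries τ ℂ) * X) ^ m i) := by
    rw [Fintype.prod_sigma]
    refine Finset.prod_congr rfl fun i _ => ?_
    rw [← prod_rootsOfUnity_one_add (m i) (θ i) (hθ i)]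
    refine Finset.prod_congr rfl fun z _ => ?_
    have : rootWeight m θ ⟨i, z⟩ =
        algebraMap ℂ _ (θ i * ((z : ℂˣ) : ℂ)) * (MvPowerSeries.X i : MvPowerSeries τ ℂ) := by
      rw [rootWeight, MvPowerSeries.X, MvPowerSeries.algebraMap_apply, ← MvPowerSeries.monomial_zero_eq_C_apply,
        MvPowerSeries.monomial_mul_monomial]
      simp
    rw [this, map_mul, mul_assoc]
    rfl
  have h2 := congrArg (fun p : (MvPowerSeries τ ℂ)[X] => p.coeff k) h1
  simp only [Finset.prod_one_add, mul_pow] at h2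
  simp only [Finset.prod_mul_distrib, Finset.prod_const, ← map_pow, ← map_prod, finsetSum_coeff,
    Finset.prod_pow_eq_pow_sum, coeff_C_mul, coeff_X_pow, mul_ite, mul_one, mul_zero] at h2
  rw [← Finset.sum_filter, ← Finset.sum_filter] at h2
  have hf : (Finset.univ : Finset (RootColour m)).powerset.filter (fun s => k = s.card) =
      Finset.univ.powersetCard k := by
    ext s; simp [eq_comm]
  rw [hf] at h2
  rw [h2]
  refine Finset.sum_congr ?_ fun J _ => ?_
  · ext J; simp [eq_comm]
  · have : ∀ J : Finset τ, ∏ i ∈ J, (MvPowerSeries.X i : MvPowerSeries τ ℂ) ^ m i =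
        MvPowerSeries.monomial (∑ i ∈ J, Finsupp.single i (m i)) (1 : ℂ) := by
      intro J
      induction J using Finset.induction_on with
      | empty => simp
      | insert i J hi ih =>
        rw [Finset.prod_insert hi, Finset.sum_insert hi, ih, MvPowerSeries.X_pow_eq,
          MvPowerSeries.monomial_mul_monomial, one_mul]
    exact this J

/-! ### Deletion-contraction for weighted sums over colourings by roots of unity. -/

open Classical in
/-- The weighted sum over the proper colourings of `H` by the `m`-th roots of unity. -/
noncomputable def SimpleGraph.rootSum {V : Type*} [Fintype V] (H : SimpleGraph V) (a : V → ℕ)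
    (m : ℕ) [NeZero m] : ℂ :=
  ∑ κ : V → rootsOfUnity m ℂ with ∀ v w, H.Adj v w → κ v ≠ κ w,
    ∏ v, ((κ v : ℂˣ) : ℂ) ^ a v

theorem SimpleGraph.exists_separation {V : Type*} {H : SimpleGraph V} (h : ¬ H.Preconnected) :
    ∃ A : Set V, A.Nonempty ∧ Aᶜ.Nonempty ∧ ∀ v w, H.Adj v w → (v ∈ A ↔ w ∈ A) := by
  simp only [SimpleGraph.Preconnected, not_forall] at h
  obtain ⟨u, v, huv⟩ := h
  refine ⟨{w | H.Reachable u w}, ⟨u, SimpleGraph.Reachable.refl u⟩, ⟨v, huv⟩, ?_⟩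
  intro x y hxy
  exact ⟨fun h => h.trans hxy.reachable, fun h => h.trans hxy.symm.reachable⟩

/-- Multiplying the colours on a union of components `A` by a primitive root permutes the proper
colourings and scales the sum by `η`. Here `η ≠ 1`, since the weight of `A` lies strictly between
`0` and `m`. -/
theorem SimpleGraph.rootSum_eq_zero {V : Type*} [Fintype V] (H : SimpleGraph V) (a : V → ℕ)
    (m : ℕ) [NeZero m] (ha : ∀ v, 0 < a v) (hsum : ∑ v, a v = m) (h : ¬ H.Preconnected) :
    H.rootSum a m = 0 := by
  classical
  obtain ⟨A, ⟨x, hx⟩, ⟨y, hy⟩, hA⟩ := H.exists_separation h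
  have hm : m ≠ 0 := NeZero.ne m
  have hζ := Complex.isPrimitiveRoot_exp m hm
  set ζ := hζ.toRootsOfUnity with hζdef
  set η : ℂ := ((ζ : ℂˣ) : ℂ) ^ (∑ v with v ∈ A, a v) with hη
  have hη1 : η ≠ 1 := by
    apply IsPrimitiveRoot.pow_ne_one_of_pos_of_lt (k := m)
    · exact hζ
    · have : a x ≤ ∑ v with v ∈ A, a v :=
        Finset.single_le_sum (fun _ _ => Nat.zero_le _) (by simpa using hx)
      have := ha x
      omega
    · rw [← hsum]
      refine Finset.sum_lt_sum_of_subset (Finset.filter_subset _ _) (i := y) (Finset.mem_univ _)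
        (by simpa using hy) (ha y) (fun _ _ _ => Nat.zero_le _)
  have key : H.rootSum a m = η * H.rootSum a m := by
    conv_lhs => rw [SimpleGraph.rootSum]
    rw [SimpleGraph.rootSum, Finset.mul_sum]
    symm
    refine Finset.sum_bij (fun κ _ v => if v ∈ A then ζ * κ v else κ v) ?_ ?_ ?_ ?_
    · intro κ hκ
      simp only [Finset.mem_filter, Finset.mem_univ, true_and] at hκ ⊢
      intro v w hvw
      have := hκ v w hvw
      have h2 := hA v w hvw
      by_cases h : w ∈ A
      · simpa [h2.2 h, h] using this
      · simpa [mt h2.1 h, h] using this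
    · intro κ _ κ' _ h
      funext v
      have := congrFun h v
      by_cases hv : v ∈ A <;> simpa [hv] using this
    · intro κ hκ
      simp only [Finset.mem_filter, Finset.mem_univ, true_and] at hκ
      refine ⟨fun v => if v ∈ A then ζ⁻¹ * κ v else κ v, ?_, ?_⟩
      · simp only [Finset.mem_filter, Finset.mem_univ, true_and]
        intro v w hvw
        have := hκ v w hvw
        have h2 := hA v w hvw
        by_cases h : w ∈ A
        · simpa [h2.2 h, h] using this
        · simpa [mt h2.1 h, h] using this
      · funext v
        by_cases hv : v ∈ A <;> simp [hv]
    · intro κ _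
      rw [hη, ← Finset.prod_pow_eq_pow_sum, Finset.prod_filter, ← Finset.prod_mul_distrib]
      refine Finset.prod_congr rfl fun v _ => ?_
      by_cases hv : v ∈ A <;> simp [hv, mul_pow]
  have : (1 - η) * H.rootSum a m = 0 := by rw [sub_mul, one_mul, ← key, sub_self]
  exact (mul_eq_zero.1 this).resolve_left (sub_ne_zero.2 hη1.symm)

/-- Contraction of the graph `H` along the map `f`, with loops removed. -/
def SimpleGraph.contract {V W : Type*} (H : SimpleGraph V) (f : V → W) : SimpleGraph W :=
  SimpleGraph.fromRel fun x y => ∃ x' y', f x' = x ∧ f y' = y ∧ H.Adj x' y'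

theorem SimpleGraph.contract_adj {V W : Type*} (H : SimpleGraph V) (f : V → W) (x y : W) :
    (H.contract f).Adj x y ↔ x ≠ y ∧ ∃ x' y', f x' = x ∧ f y' = y ∧ H.Adj x' y' := by
  rw [contract, SimpleGraph.fromRel_adj]
  refine and_congr_right fun _ => ⟨?_, Or.inl⟩
  rintro (h | ⟨y', x', h1, h2, h3⟩)
  · exact h
  · exact ⟨x', y', h2, h1, h3.symm⟩

theorem SimpleGraph.Preconnected.contract {V W : Type*} {H : SimpleGraph V}
    (h : H.Preconnected) {f : V → W} (hf : Function.Surjective f) :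
    (H.contract f).Preconnected := by
  by_contra hc
  obtain ⟨A, ⟨x, hx⟩, ⟨y, hy⟩, hA⟩ := SimpleGraph.exists_separation hc
  obtain ⟨x, rfl⟩ := hf x
  obtain ⟨y, rfl⟩ := hf y
  have : ∀ v w, H.Adj v w → (f v ∈ A ↔ f w ∈ A) := by
    intro v w hvw
    by_cases hfe : f v = f w
    · rw [hfe]
    · exact hA _ _ ((H.contract_adj f _ _).2 ⟨hfe, v, w, rfl, rfl, hvw⟩)
  obtain ⟨p⟩ := h x y
  have hp : ∀ {u v : V} (p : H.Walk u v), f u ∈ A → f v ∈ A := by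
    intro u v p
    induction p with
    | nil => exact id
    | cons h _ ih => exact fun hu => ih ((this _ _ h).1 hu)
  exact hy (hp p hx)

/-- Proper colourings of `H` without the edge `uv` either separate `u` and `v`, so are proper for
`H`, or agree there and factor through `f`. The hypothesis `hb` says that `b` adds the weights along
fibres of `f`. -/
theorem SimpleGraph.rootSum_eq_sub {V W : Type*} [Fintype V] [Fintype W] (H : SimpleGraph V)
    (a : V → ℕ) (m : ℕ) [NeZero m] {u v : V} (huv : H.Adj u v) (f : V → W)
    (hf : Function.Surjective f) (hfuv : f u = f v)
    (hf' : ∀ x y, f x = f y → x = y ∨ s(x, y) = s(u, v)) (b : W → ℕ)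
    (hb : ∀ (z : W → ℂ), ∏ x, z (f x) ^ a x = ∏ y, z y ^ b y) :
    H.rootSum a m = (H.deleteEdges {s(u, v)}).rootSum a m - (H.contract f).rootSum b m := by
  classical
  rw [eq_sub_iff_add_eq]
  simp only [SimpleGraph.rootSum]
  have h1 := Finset.sum_filter_add_sum_filter_not
    (Finset.univ.filter fun κ : V → rootsOfUnity m ℂ =>
      ∀ v' w, (H.deleteEdges {s(u, v)}).Adj v' w → κ v' ≠ κ w) (fun κ => κ u ≠ κ v)
    (fun κ => ∏ v, ((κ v : ℂˣ) : ℂ) ^ a v)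
  refine Eq.trans ?_ (h1.trans (by congr!))
  congr 1
  · refine Finset.sum_congr ?_ fun _ _ => rfl
    ext κ
    simp only [Finset.mem_filter, Finset.mem_univ, true_and, SimpleGraph.deleteEdges_adj,
      Set.mem_singleton_iff]
    constructor
    · intro h
      exact ⟨fun x y hxy => h x y hxy.1, h u v huv⟩
    · rintro ⟨h, h'⟩ x y hxy
      by_cases he : s(x, y) = s(u, v)
      · rw [Sym2.eq_iff] at he
        rcases he with ⟨rfl, rfl⟩ | ⟨rfl, rfl⟩
        · exact h'
        · exact h'.symm
      · exact h x y ⟨hxy, he⟩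
  · refine Finset.sum_bij (fun κ _ => κ ∘ f) ?_ ?_ ?_ ?_
    · intro κ hκ
      simp only [Finset.mem_filter, Finset.mem_univ, true_and, SimpleGraph.deleteEdges_adj,
        Set.mem_singleton_iff, contract_adj] at hκ ⊢
      refine ⟨fun x y hxy => ?_, by simp [hfuv]⟩
      refine hκ _ _ ⟨fun he => ?_, x, y, rfl, rfl, hxy.1⟩
      rcases hf' x y he with rfl | h
      · exact hxy.1.ne rfl
      · exact hxy.2 h
    · intro κ _ κ' _ h
      exact hf.injective_comp_right h
    · intro κ hκ
      simp only [Finset.mem_filter, Finset.mem_univ, true_and, SimpleGraph.deleteEdges_adj,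
        Set.mem_singleton_iff, not_not] at hκ
      have hfac : ∀ x y, f x = f y → κ x = κ y := by
        intro x y h
        rcases hf' x y h with rfl | h
        · rfl
        · rw [Sym2.eq_iff] at h
          rcases h with ⟨rfl, rfl⟩ | ⟨rfl, rfl⟩
          · exact hκ.2
          · exact hκ.2.symm
      have hval : ∀ x, κ (Function.surjInv hf (f x)) = κ x :=
        fun x => hfac _ _ (Function.surjInv_eq hf _)
      refine ⟨κ ∘ Function.surjInv hf, ?_, funext hval⟩
      simp only [Finset.mem_filter, Finset.mem_univ, true_and, contract_adj]
      rintro x y ⟨hne, x, y, rfl, rfl, hxy⟩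
      simp only [Function.comp_apply, hval]
      refine hκ.1 x y ⟨hxy, fun he => hne ?_⟩
      rw [Sym2.eq_iff] at he
      rcases he with ⟨rfl, rfl⟩ | ⟨rfl, rfl⟩
      · exact hfuv
      · exact hfuv.symm
    · intro κ _
      exact (hb fun y => ((κ y : ℂˣ) : ℂ)).symm

theorem card_rootsOfUnity_complex (m : ℕ) [NeZero m] : Fintype.card (rootsOfUnity m ℂ) = m :=
  Fintype.card_eq_nat_card.trans
    (Complex.isPrimitiveRoot_exp m (NeZero.ne m)).card_rootsOfUnity

/-- Deletion-contraction determines the sign of the weighted sum. -/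
theorem SimpleGraph.exists_rootSum_eq (m : ℕ) [NeZero m] (N : ℕ) :
    ∀ {V : Type*} [Fintype V] (H : SimpleGraph V) (a : V → ℕ), Fintype.card V = N →
      (∀ v, 0 < a v) → ∑ v, a v = m →
      ∃ k : ℕ, (H.Preconnected → 0 < k) ∧ H.rootSum a m = (-1) ^ (N + 1) * k := by
  classical
  induction N with
  | zero =>
    intro V _ H a hV _ hs
    have := Fintype.card_eq_zero_iff.1 hV
    exact absurd (by simpa using hs) (NeZero.ne m).symm
  | succ N ih =>
    intro V _ H a hV ha hs
    induction hE : H.edgeSet.ncard using Nat.strong_induction_on generalizing H with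
    | _ E ihE =>
    by_cases hc : H.Preconnected
    swap
    · exact ⟨0, fun h => absurd h hc, by rw [H.rootSum_eq_zero a m ha hs hc]; simp⟩
    by_cases he : ∃ u v, H.Adj u v
    · obtain ⟨u, v, huv⟩ := he
      obtain ⟨k₁, -, h₁⟩ := ihE _ (by
        rw [← hE]
        apply Set.ncard_lt_ncard
        · rw [SimpleGraph.edgeSet_deleteEdges]
          refine Set.ssubset_iff_subset_ne.2 ⟨Set.sdiff_subset, fun h => ?_⟩
          have huv' : s(u, v) ∈ H.edgeSet := huv
          rw [← h] at huv'
          exact huv'.2 rfl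
        · exact Set.toFinite _) (H.deleteEdges {s(u, v)}) rfl
      -- Contraction merges `u` into `v`. The deletion and contraction terms enter with the same
      -- sign, and the contraction of a connected graph is connected, so `k₂` alone ensures
      -- positivity.
      let f : V → {w : V // w ≠ u} := fun w => if h : w = u then ⟨v, huv.ne'⟩ else ⟨w, h⟩
      have hfu : f u = ⟨v, huv.ne'⟩ := by simp [f]
      have hfw : ∀ w (h : w ≠ u), f w = ⟨w, h⟩ := fun w h => by simp [f, h]
      have hf : Function.Surjective f := fun w => ⟨w, hfw w w.2⟩
      let b : {w : V // w ≠ u} → ℕ := fun w => ∑ x with f x = w, a x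
      have hbpos : ∀ w, 0 < b w := by
        intro w
        exact Finset.sum_pos (fun x _ => ha x) ⟨w, by simp [hfw w w.2]⟩
      have hbsum : ∑ w, b w = m := by
        rw [← hs]
        exact Finset.sum_fiberwise _ _ _
      obtain ⟨k₂, hk₂, h₂⟩ := ih (H.contract f) b (by
        rw [Fintype.card_subtype_compl, hV]; simp) hbpos hbsum
      refine ⟨k₁ + k₂, fun _ => by have := hk₂ (hc.contract hf); omega, ?_⟩
      rw [H.rootSum_eq_sub a m huv f hf (by rw [hfu, hfw v huv.ne']) ?_ b ?_, h₁, h₂]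
      · push_cast; ring
      · intro x y hxy
        by_cases hx : x = u
        · subst hx
          by_cases hy : y = x
          · exact Or.inl hy.symm
          · rw [hfu, hfw y hy, Subtype.mk.injEq] at hxy
            exact Or.inr (by rw [hxy])
        · by_cases hy : y = u
          · subst hy
            rw [hfu, hfw x hx, Subtype.mk.injEq] at hxy
            exact Or.inr (by rw [hxy, Sym2.eq_swap])
          · rw [hfw x hx, hfw y hy, Subtype.mk.injEq] at hxy
            exact Or.inl hxy
      · intro z
        rw [← Finset.prod_fiberwise _ f]
        refine Finset.prod_congr rfl fun w _ => ?_
        rw [← Finset.prod_pow_eq_pow_sum]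
        refine Finset.prod_congr rfl fun x hx => ?_
        rw [(Finset.mem_filter.1 hx).2]
    · push Not at he
      have hsub : ∀ x y : V, x = y := by
        intro x y
        obtain ⟨p⟩ := hc x y
        cases p with
        | nil => rfl
        | cons h _ => exact absurd h (he _ _)
      have hN : N = 0 := by
        have : Subsingleton V := ⟨hsub⟩
        have := Fintype.card_le_one_iff_subsingleton.2 this
        omega
      subst hN
      obtain ⟨x, hx⟩ := Fintype.card_eq_one_iff.1 hV
      -- A single vertex of weight `m` has `m` colourings, each contributing `1`.
      refine ⟨m, fun _ => Nat.pos_of_ne_zero (NeZero.ne m), ?_⟩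
      have hprod : ∀ κ : V → rootsOfUnity m ℂ, ∏ v, ((κ v : ℂˣ) : ℂ) ^ a v = 1 := by
        intro κ
        rw [Finset.prod_congr rfl (g := fun v => ((κ x : ℂˣ) : ℂ) ^ a v)
          (fun v _ => by rw [hx v]), Finset.prod_pow_eq_pow_sum, hs]
        exact (mem_rootsOfUnity' _ _).1 (κ x).2
      rw [SimpleGraph.rootSum, Finset.sum_congr rfl (fun κ _ => hprod κ)]
      simp only [Finset.sum_const, nsmul_eq_mul, mul_one]
      rw [Finset.filter_true_of_mem (fun κ _ v w h => absurd h (he v w)), Finset.card_univ,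
        Fintype.card_fun, card_rootsOfUnity_complex, hV]
      simp

theorem SimpleGraph.Connected.rootSum_ne_zero {V : Type*} [Fintype V] {G : SimpleGraph V}
    (hG : G.Connected) (m : ℕ) [NeZero m] (hm : Fintype.card V = m) :
    G.rootSum (fun _ => 1) m ≠ 0 := by
  obtain ⟨k, hk, h⟩ := SimpleGraph.exists_rootSum_eq m (Fintype.card V) G (fun _ => 1) rfl
    (fun _ => one_pos) (by simp [hm])
  rw [h]
  have := hk hG.preconnected
  simp
  omega

/-! ### Connected partitions from `e`-positivity. -/

theorem prod_rootWeight {V τ : Type*} [Fintype V] (m : τ → ℕ) (θ : τ → ℂ)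
    (κ : V → RootColour m) :
    ∏ v, rootWeight m θ (κ v) = MvPowerSeries.monomial (∑ v, Finsupp.single (κ v).1 1)
      (∏ v, θ (κ v).1 * (((κ v).2 : ℂˣ) : ℂ)) := by
  classical
  have : ∀ s : Finset V, ∏ v ∈ s, rootWeight m θ (κ v) =
      MvPowerSeries.monomial (∑ v ∈ s, Finsupp.single (κ v).1 1)
        (∏ v ∈ s, θ (κ v).1 * (((κ v).2 : ℂˣ) : ℂ)) := by
    intro s
    induction s using Finset.induction_on with
    | empty => simp
    | insert v s hv ih =>
      rw [Finset.prod_insert hv, Finset.prod_insert hv, Finset.sum_insert hv, ih, rootWeight,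
        MvPowerSeries.monomial_mul_monomial]
  exact this Finset.univ

open Classical in
/-- If the sum over the colourings by roots of unity contains the monomial `∏ i, X_i ^ m i`, then
the graph has a partition into connected blocks of sizes `m i`. -/
theorem exists_connected_partition_of_coeff_ne_zero {V τ : Type*} [Fintype V] [Fintype τ]
    (G : SimpleGraph V) (m : τ → ℕ) [∀ i, NeZero (m i)] (θ : τ → ℂ)
    (h : MvPowerSeries.coeff (∑ i, Finsupp.single i (m i))
      (∑ κ : V → RootColour m with ∀ v w, G.Adj v w → κ v ≠ κ w, ∏ v, rootWeight m θ (κ v)) ≠ 0) :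
    ∃ p : V → τ, (∀ i, (Finset.univ.filter fun v => p v = i).card = m i) ∧
      ∀ i, (G.induce {v | p v = i}).Preconnected := by
  rw [map_sum, ← Finset.sum_fiberwise _ (fun κ v => (κ v).1)] at h
  obtain ⟨p, -, hp⟩ := Finset.exists_ne_zero_of_sum_ne_zero h
  have hsum : ∑ v, Finsupp.single (p v) 1 = ∑ i, Finsupp.single i (m i) := by
    obtain ⟨κ, hκ, hne⟩ := Finset.exists_ne_zero_of_sum_ne_zero hp
    rw [prod_rootWeight, MvPowerSeries.coeff_monomial] at hne
    have := (Finset.mem_filter.1 hκ).2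
    subst this
    exact (ite_ne_right_iff.1 hne).1.symm
  have hcard : ∀ i, (Finset.univ.filter fun v => p v = i).card = m i := by
    intro i
    have := DFunLike.congr_fun hsum i
    simp only [Finsupp.finsetSum_apply, Finsupp.single_apply, Finset.sum_ite_eq',
      Finset.mem_univ, if_true] at this
    rw [← this, Finset.card_filter]
  refine ⟨p, hcard, ?_⟩
  by_contra hcon
  push Not at hcon
  obtain ⟨i, hi⟩ := hcon
  apply hp
  obtain ⟨A', ⟨x, hx⟩, ⟨y, hy⟩, hA'⟩ := SimpleGraph.exists_separation hi
  -- `A` is a proper nonempty part of block `i` with no edge to the rest of that block. Rotating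
  -- colours on `A` by `ζ` keeps colourings proper, as different blocks never share a colour.
  set A : Finset V := Finset.univ.filter fun v => ∃ h : p v = i, (⟨v, h⟩ : {v | p v = i}) ∈ A'
    with hAdef
  have hAi : ∀ v ∈ A, p v = i := fun v hv => (Finset.mem_filter.1 hv).2.1
  have hA : ∀ v w, G.Adj v w → p v = p w → (v ∈ A ↔ w ∈ A) := by
    intro v w hvw hpvw
    by_cases hv : p v = i
    · have hw : p w = i := hpvw ▸ hv
      have := hA' ⟨v, hv⟩ ⟨w, hw⟩ hvw
      simpa [hAdef, hv, hw] using this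
    · exact ⟨fun h => absurd (hAi v h) hv, fun h => absurd (hpvw.trans (hAi w h)) hv⟩
  have hζ := Complex.isPrimitiveRoot_exp (m i) (NeZero.ne (m i))
  set ζ := hζ.toRootsOfUnity
  set η : ℂ := ((ζ : ℂˣ) : ℂ) ^ A.card with hη
  have hη1 : η ≠ 1 := by
    apply IsPrimitiveRoot.pow_ne_one_of_pos_of_lt (k := m i) hζ
    · refine (Finset.card_pos.2 ⟨x.1, ?_⟩).ne'
      simp only [hAdef, Finset.mem_filter, Finset.mem_univ, true_and]
      exact ⟨x.2, hx⟩
    · rw [← hcard i]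
      refine Finset.card_lt_card (Finset.ssubset_iff_subset_ne.2 ⟨fun v hv => ?_, fun heq => ?_⟩)
      · simpa using hAi v hv
      · have : y.1 ∈ A := by
          rw [heq]; exact Finset.mem_filter.2 ⟨Finset.mem_univ _, y.2⟩
        obtain ⟨_, h⟩ := (Finset.mem_filter.1 this).2
        exact hy h
  set S : Finset (V → RootColour m) := {κ ∈ Finset.univ.filter
    (fun κ : V → RootColour m => ∀ v w, G.Adj v w → κ v ≠ κ w) | (fun v => (κ v).1) = p} with hS
  let t : ((j : τ) → rootsOfUnity (m j) ℂ) → RootColour m → RootColour m :=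
    fun z c => ⟨c.1, z c.1 * c.2⟩
  have ht : ∀ z c, t z⁻¹ (t z c) = c := fun z c =>
    Sigma.ext rfl (heq_of_eq (inv_mul_cancel_left (z c.1) c.2))
  let tw : ((j : τ) → rootsOfUnity (m j) ℂ) → (V → RootColour m) → V → RootColour m :=
    fun z κ v => if v ∈ A then t z (κ v) else κ v
  have htwA : ∀ z κ v, v ∈ A → tw z κ v = t z (κ v) := fun z κ v hv => if_pos hv
  have htwN : ∀ z κ v, v ∉ A → tw z κ v = κ v := fun z κ v hv => if_neg hv
  have htw : ∀ z κ, κ ∈ S → tw z κ ∈ S := by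
    intro z κ hκ
    simp only [hS, Finset.mem_filter, Finset.mem_univ, true_and] at hκ ⊢
    have hfst : ∀ v, (tw z κ v).1 = p v := by
      intro v
      rw [← congrFun hκ.2 v]
      by_cases hv : v ∈ A
      · rw [htwA z κ v hv]
      · rw [htwN z κ v hv]
    refine ⟨fun v w hvw heq => ?_, funext hfst⟩
    have hpvw : p v = p w := by rw [← hfst, ← hfst, heq]
    have h2 := hA v w hvw hpvw
    apply hκ.1 v w hvw
    by_cases hw : w ∈ A
    · rw [htwA _ _ _ hw, htwA _ _ _ (h2.2 hw)] at heq
      rw [← ht z (κ v), heq, ht]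
    · rwa [htwN _ _ _ hw, htwN _ _ _ (mt h2.1 hw)] at heq
  have hinv : ∀ z κ, tw z⁻¹ (tw z κ) = κ := by
    intro z κ
    funext v
    by_cases hv : v ∈ A
    · rw [htwA _ _ _ hv, htwA _ _ _ hv, ht]
    · rw [htwN _ _ _ hv, htwN _ _ _ hv]
  let Z : (j : τ) → rootsOfUnity (m j) ℂ := Function.update (fun _ => 1) i ζ
  set e := ∑ i, Finsupp.single i (m i) with he
  have hcoeff : ∀ κ ∈ S, MvPowerSeries.coeff e (∏ v, rootWeight m θ (κ v)) =
      ∏ v, θ (κ v).1 * (((κ v).2 : ℂˣ) : ℂ) := by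
    intro κ hκ
    have h1 : (fun v => (κ v).1) = p := (Finset.mem_filter.1 hκ).2
    rw [prod_rootWeight, MvPowerSeries.coeff_monomial, if_pos]
    rw [← hsum]
    exact Finset.sum_congr rfl fun v _ => by rw [← congrFun h1 v]
  rw [Finset.sum_congr rfl hcoeff]
  have key : ∑ κ ∈ S, ∏ v, θ (κ v).1 * (((κ v).2 : ℂˣ) : ℂ) =
      η * ∑ κ ∈ S, ∏ v, θ (κ v).1 * (((κ v).2 : ℂˣ) : ℂ) := by
    rw [Finset.mul_sum]
    symm
    refine Finset.sum_bij (fun κ _ => tw Z κ) (fun κ hκ => htw Z κ hκ) ?_ ?_ ?_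
    · intro κ _ κ' _ h
      rw [← hinv Z κ, ← hinv Z κ', h]
    · intro κ hκ
      refine ⟨tw Z⁻¹ κ, htw _ κ hκ, ?_⟩
      simpa using hinv Z⁻¹ κ
    · intro κ hκ
      have h1 : (fun v => (κ v).1) = p := (Finset.mem_filter.1 hκ).2
      rw [hη, ← Finset.prod_const, ← Finset.prod_filter_mul_prod_filter_not Finset.univ (· ∈ A),
        ← Finset.prod_filter_mul_prod_filter_not Finset.univ (· ∈ A)
          (fun v => θ (tw Z κ v).1 * (((tw Z κ v).2 : ℂˣ) : ℂ)), ← mul_assoc]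
      have hAf : Finset.univ.filter (· ∈ A) = A := by ext; simp
      rw [hAf, ← Finset.prod_mul_distrib]
      congr 1
      · refine Finset.prod_congr rfl fun v hv => ?_
        have h2 : (κ v).1 = i := (congrFun h1 v).trans (hAi v hv)
        have : ((Z (κ v).1 : ℂˣ) : ℂ) = ((ζ : ℂˣ) : ℂ) := by
          rw [h2]; simp [Z]
        rw [htwA _ _ _ hv]
        change ((ζ : ℂˣ) : ℂ) * (θ (κ v).1 * (((κ v).2 : ℂˣ) : ℂ)) =
          θ (κ v).1 * (((Z (κ v).1 : ℂˣ) : ℂ) * (((κ v).2 : ℂˣ) : ℂ))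
        rw [this]
        ring
      · refine Finset.prod_congr rfl fun v hv => ?_
        rw [htwN _ _ _ (Finset.mem_filter.1 hv).2]
  have h0 : (1 - η) * ∑ κ ∈ S, ∏ v, θ (κ v).1 * (((κ v).2 : ℂˣ) : ℂ) = 0 := by
    rw [sub_mul, one_mul, ← key, sub_self]
  exact (mul_eq_zero.1 h0).resolve_left (sub_ne_zero.2 hη1.symm)

-- With a single block, the coefficient is `θ () ^ n` times the root sum with all weights `1`.
open Classical in
theorem SimpleGraph.Connected.coeff_rootWeight_ne_zero {V : Type*} [Fintype V] {G : SimpleGraph V}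
    (hG : G.Connected) (n : ℕ) [NeZero n] (hn : Fintype.card V = n) (θ : Unit → ℂ)
    (hθ : θ () ≠ 0) :
    MvPowerSeries.coeff (Finsupp.single () n)
      (∑ κ : V → RootColour (fun _ : Unit => n) with ∀ v w, G.Adj v w → κ v ≠ κ w,
        ∏ v, rootWeight (fun _ : Unit => n) θ (κ v)) ≠ 0 := by
  have key : MvPowerSeries.coeff (Finsupp.single () n)
      (∑ κ : V → RootColour (fun _ : Unit => n) with ∀ v w, G.Adj v w → κ v ≠ κ w,
        ∏ v, rootWeight (fun _ : Unit => n) θ (κ v)) =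
      θ () ^ n * G.rootSum (fun _ => 1) n := by
    rw [map_sum, SimpleGraph.rootSum, Finset.mul_sum]
    refine Finset.sum_bij (fun κ _ v => (κ v).2) ?_ ?_ ?_ ?_
    · intro κ hκ
      simp only [Finset.mem_filter, Finset.mem_univ, true_and] at hκ ⊢
      exact fun v w hvw h => hκ v w hvw (Sigma.ext rfl (heq_of_eq h))
    · intro κ _ κ' _ h
      exact funext fun v => Sigma.ext rfl (heq_of_eq (congrFun h v))
    · intro κ hκ
      simp only [Finset.mem_filter, Finset.mem_univ, true_and] at hκ
      refine ⟨fun v => ⟨(), κ v⟩, ?_, rfl⟩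
      simp only [Finset.mem_filter, Finset.mem_univ, true_and]
      intro v w hvw h
      exact hκ v w hvw (by simpa using h)
    · intro κ _
      rw [prod_rootWeight, MvPowerSeries.coeff_monomial, if_pos, Finset.prod_mul_distrib]
      · have : ∀ v, θ (κ v).1 = θ () := fun _ => rfl
        simp [this, hn]
      · ext
        simp [hn]
  rw [key]
  exact mul_ne_zero (pow_ne_zero _ hθ) (hG.rootSum_ne_zero n hn)

theorem constantCoeff_rootWeight {τ : Type*} (m : τ → ℕ) (θ : τ → ℂ) (c : RootColour m) :
    MvPowerSeries.constantCoeff (rootWeight m θ c) = 0 := by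
  classical
  rw [← MvPowerSeries.coeff_zero_eq_constantCoeff_apply, rootWeight,
    MvPowerSeries.coeff_monomial, if_neg]
  intro h
  simpa using DFunLike.congr_fun h c.1

theorem exists_pow_eq_neg_one_pow {k : ℕ} (hk : k ≠ 0) : ∃ θ : ℂ, θ ^ k = (-1) ^ (k - 1) :=
  IsAlgClosed.exists_pow_nat_eq _ (Nat.pos_of_ne_zero hk)

theorem coeff_algHom_sum {σ : Type*} (Ψ : MvPowerSeries ℕ ℚ →ₐ[ℚ] MvPowerSeries σ ℂ)
    (c : (Σ N : ℕ, N.Partition) →₀ ℚ) (d : σ →₀ ℕ) :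
    MvPowerSeries.coeff d (Ψ (c.sum fun p a => a • elementarySymmetricPart p.2)) =
      ∑ q ∈ c.support, (c q : ℂ) * MvPowerSeries.coeff d (Ψ (elementarySymmetricPart q.2)) := by
  rw [Finsupp.sum, map_sum, map_sum]
  refine Finset.sum_congr rfl fun q _ => ?_
  rw [map_smul, ← Rat.smul_def]
  rfl

/-- The coefficient of `e_n` in the chromatic symmetric function of a connected graph with `n`
vertices does not vanish. -/
theorem SimpleGraph.Connected.exists_mem_support {V : Type*} [Fintype V] {G : SimpleGraph V}
    (hG : G.Connected) {n : ℕ} (hn : Fintype.card V = n) (hn0 : n ≠ 0)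
    (c : (Σ N : ℕ, N.Partition) →₀ ℚ)
    (hc : chromaticSymmetricFunction G = c.sum fun p a => a • elementarySymmetricPart p.2) :
    ∃ q ∈ c.support, q.2.parts = {n} := by
  classical
  have : NeZero n := ⟨hn0⟩
  obtain ⟨θ, hθ⟩ := exists_pow_eq_neg_one_pow hn0
  have hθ0 : θ ≠ 0 := by
    rintro rfl
    rw [zero_pow hn0] at hθ
    exact pow_ne_zero _ (by norm_num) hθ.symm
  obtain ⟨Φ, hΦe, hΦG⟩ := exists_specialization G _
    (constantCoeff_rootWeight (fun _ : Unit => n) (fun _ => θ))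
  have h1 : MvPowerSeries.coeff (Finsupp.single () n) (Φ (chromaticSymmetricFunction G)) ≠ 0 := by
    rw [hΦG]
    convert hG.coeff_rootWeight_ne_zero n hn (fun _ => θ) hθ0
  rw [hc, coeff_algHom_sum] at h1
  obtain ⟨q, hq, hne⟩ := Finset.exists_ne_zero_of_sum_ne_zero h1
  refine ⟨q, hq, ?_⟩
  have hne := right_ne_zero_of_mul hne
  -- With one block of size `n`, every `e_k` with `k > 0` other than `e_n` dies; comparing degrees
  -- then leaves only `λ = (n)`.
  have hek : ∀ k, 0 < k → Φ (elementarySymmetric k) =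
      if k = n then MvPowerSeries.monomial (Finsupp.single () n) (1 : ℂ) else 0 := by
    intro k hk
    rw [hΦe]
    refine (by congr! : _ = _).trans ((sum_prod_rootWeight (fun _ : Unit => n) (fun _ => θ)
      (fun _ => hθ) k).trans ?_)
    rw [Finset.sum_filter,
      ← Finset.powerset_univ, Finset.univ_unique, ← insert_empty_eq (default : Unit),
      Finset.sum_powerset_insert
        (show (default : Unit) ∉ (∅ : Finset Unit) from by simp)]
    simp [hk.ne', eq_comm]
  rw [elementarySymmetricPart, map_multiset_prod, Multiset.map_map] at hne
  have hall : ∀ k ∈ q.2.parts, k = n := by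
    intro k hk
    by_contra hkn
    apply hne
    rw [Multiset.prod_eq_zero, map_zero]
    rw [Multiset.mem_map]
    exact ⟨k, hk, by rw [Function.comp_apply, hek k (q.2.parts_pos hk), if_neg hkn]⟩
  have hrep := Multiset.eq_replicate_card.2 hall
  rw [hrep, Multiset.map_replicate, Multiset.prod_replicate, Function.comp_apply,
    hek n (Nat.pos_of_ne_zero hn0), if_pos rfl, MvPowerSeries.monomial_pow,
    MvPowerSeries.coeff_monomial] at hne
  have h2 := DFunLike.congr_fun (ite_ne_right_iff.1 hne).1 ()
  simp only [Finsupp.single_eq_same, Finsupp.smul_apply, smul_eq_mul] at h2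
  have h3 : q.2.parts.card = 1 := by
    have : 1 * n = q.2.parts.card * n := by omega
    exact (Nat.eq_of_mul_eq_mul_right (Nat.pos_of_ne_zero hn0) this).symm
  rw [hrep, h3]; rfl

/-- An `e`-positive connected graph has a partition into connected blocks of any prescribed
positive sizes with the right sum. -/
theorem SimpleGraph.Connected.exists_connected_partition {V τ : Type*} [Fintype V] [Fintype τ]
    {G : SimpleGraph V} (hG : G.Connected) (he : G.IsEPositive) (m : τ → ℕ) (hm : ∀ i, m i ≠ 0)
    (hsum : ∑ i, m i = Fintype.card V) :
    ∃ p : V → τ, (∀ i, Nat.card {v // p v = i} = m i) ∧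
      ∀ i, (G.induce {v | p v = i}).Preconnected := by
  classical
  obtain ⟨n, hn⟩ : ∃ n, Fintype.card V = n := ⟨_, rfl⟩
  have hn0 : n ≠ 0 := by
    have := hG.nonempty
    rw [← hn]; exact Fintype.card_ne_zero
  have : ∀ i, NeZero (m i) := fun i => ⟨hm i⟩
  choose θ hθ using fun i => exists_pow_eq_neg_one_pow (hm i)
  obtain ⟨Φ, hΦe, hΦG⟩ := exists_specialization G _ (constantCoeff_rootWeight m θ)
  obtain ⟨c, hc, hcsum⟩ := he
  obtain ⟨q, hq, hqn⟩ := hG.exists_mem_support hn hn0 c hcsum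
  have hcq : 0 < c q := lt_of_le_of_ne (hc q) (Finsupp.mem_support_iff.1 hq).symm
  -- All `e_λ` specialise to series with coefficients in `ℕ`
  have hnat : ∀ q : Σ N : ℕ, N.Partition, Φ (elementarySymmetricPart q.2) ∈
      (MvPowerSeries.map (σ := τ) (Nat.castRingHom ℂ)).rangeS := by
    intro q
    rw [elementarySymmetricPart, map_multiset_prod, Multiset.map_map]
    refine Subsemiring.multiset_prod_mem _ _ fun F hF => ?_
    obtain ⟨k, -, rfl⟩ := Multiset.mem_map.1 hF
    rw [Function.comp_apply, hΦe, sum_prod_rootWeight _ _ hθ]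
    refine Subsemiring.sum_mem _ fun J _ => ?_
    exact ⟨MvPowerSeries.monomial _ 1, by rw [MvPowerSeries.map_monomial, map_one]⟩
  choose F hF using hnat
  set e := ∑ i, Finsupp.single i (m i) with hedef
  -- The term `J = univ` in the image of `e_n` is the full monomial.
  have hpos : 0 < MvPowerSeries.coeff e (F q) := by
    refine Nat.pos_of_ne_zero fun h0 => ?_
    have h1 : MvPowerSeries.coeff e (Φ (elementarySymmetricPart q.2)) = 0 := by
      rw [← hF q, MvPowerSeries.coeff_map, h0, map_zero]
    rw [elementarySymmetricPart, hqn, Multiset.map_singleton, Multiset.prod_singleton, hΦe,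
      sum_prod_rootWeight _ _ hθ, map_sum] at h1
    simp only [MvPowerSeries.coeff_monomial, Finset.sum_boole, Nat.cast_eq_zero,
      Finset.card_eq_zero] at h1
    have : Finset.univ ∈ (∅ : Finset (Finset τ)) := by
      rw [← h1]
      simp [hsum, hn, hedef]
    simp at this
  have hfinal : MvPowerSeries.coeff e (Φ (chromaticSymmetricFunction G)) ≠ 0 := by
    rw [hcsum, coeff_algHom_sum]
    have : ∑ q ∈ c.support, (c q : ℂ) * MvPowerSeries.coeff e (Φ (elementarySymmetricPart q.2)) =
        ((∑ q ∈ c.support, c q * ((MvPowerSeries.coeff e (F q) : ℕ) : ℚ) : ℚ) : ℂ) := by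
      push_cast
      refine Finset.sum_congr rfl fun q _ => ?_
      rw [← hF q, MvPowerSeries.coeff_map]
      rfl
    rw [this]
    refine Rat.cast_ne_zero.2 (ne_of_gt ?_)
    refine Finset.sum_pos' (fun q _ => mul_nonneg (hc q) (Nat.cast_nonneg _)) ⟨q, hq, ?_⟩
    exact mul_pos hcq (Nat.cast_pos.2 hpos)
  rw [hΦG] at hfinal
  obtain ⟨p, hp, hconn⟩ := exists_connected_partition_of_coeff_ne_zero G m θ
    (by convert hfinal)
  refine ⟨p, fun i => ?_, hconn⟩
  rw [← hp i, Nat.card_eq_fintype_card, Fintype.card_subtype]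

/-! ### Sizes of the components left by a vertex deletion. -/

theorem two_pow_le_sum_of_residues {K : Type*} [Fintype K] [DecidableEq K] (f : K → ℕ)
    (hf : ∀ C, 0 < f C)
    (h : ∀ m, 0 < m → ∃ C₀, ∑ C ∈ Finset.univ.erase C₀, f C % m < m) (S : Finset K) :
    S.Nonempty → 2 ^ (S.card - 1) ≤ ∑ C ∈ S, f C := by
  induction hS : S.card using Nat.strong_induction_on generalizing S with
  | _ N ih =>
  intro hne
  obtain ⟨M, hM, hmax⟩ := S.exists_max_image f hne
  -- Modulo `f M + 1` the values on `S` are their own residues. Omitting `M` instead of `C₀` only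
  -- lowers the sum, so `f M` dominates the rest and the total is at least twice the sum over
  -- `S.erase M`.
  obtain ⟨C₀, hC₀⟩ := h (f M + 1) (Nat.succ_pos _)
  have h1 : ∑ C ∈ S.erase C₀, f C ≤ f M := by
    refine Nat.lt_succ_iff.1 (lt_of_le_of_lt ?_ hC₀)
    calc ∑ C ∈ S.erase C₀, f C = ∑ C ∈ S.erase C₀, f C % (f M + 1) :=
          Finset.sum_congr rfl fun C hC => (Nat.mod_eq_of_lt
            (Nat.lt_succ_of_le (hmax C (Finset.mem_of_mem_erase hC)))).symm
      _ ≤ _ := Finset.sum_le_sum_of_subset (Finset.erase_subset_erase _ (Finset.subset_univ _))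
  have h2 : ∑ C ∈ S.erase M, f C ≤ f M := by
    refine le_trans ?_ h1
    by_cases hC : C₀ ∈ S
    · have e1 := Finset.add_sum_erase S f hC
      have e2 := Finset.add_sum_erase S f hM
      have := hmax C₀ hC
      omega
    · rw [Finset.erase_eq_of_notMem hC]
      exact Finset.sum_le_sum_of_subset (Finset.erase_subset _ _)
  have h3 := Finset.add_sum_erase S f hM
  have hcard := Finset.card_erase_of_mem hM
  by_cases he : (S.erase M).Nonempty
  · have h4 := ih _ (by have := hne.card_pos; omega) (S.erase M) rfl he
    have h5 := he.card_pos
    obtain ⟨k, hk⟩ : ∃ k, N = k + 2 := ⟨N - 2, by omega⟩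
    rw [hcard, hS, hk] at h4
    rw [hk, show k + 2 - 1 = k + 1 from rfl, pow_succ]
    simp only [show k + 2 - 1 - 1 = k from rfl] at h4
    omega
  · rw [Finset.not_nonempty_iff_eq_empty] at he
    rw [he, Finset.card_empty, hS] at hcard
    rw [show N - 1 = 0 from hcard.symm]
    have := hf M
    simp only [pow_zero]
    omega

/-- The existence of connected partitions into blocks of size `m` and one smaller block restricts
the residues modulo `m` of the sizes of the components of `G - v`. -/
theorem SimpleGraph.exists_sum_residues_lt {V : Type*} [Fintype V] (G : SimpleGraph V) (v : V)
    [Fintype (G.deleteVertex v).ConnectedComponent]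
    [DecidableEq (G.deleteVertex v).ConnectedComponent]
    [Nonempty (G.deleteVertex v).ConnectedComponent]
    {τ : Type*} (p : V → τ) (m : ℕ) (i₀ : τ) (hm : ∀ i, i ≠ i₀ → Nat.card {w // p w = i} = m)
    (hm₀ : Nat.card {w // p w = i₀} ≤ m) (hp : ∀ i, (G.induce {w | p w = i}).Preconnected) :
    ∃ C₀ : (G.deleteVertex v).ConnectedComponent, ∑ C ∈ Finset.univ.erase C₀,
      Nat.card {w // (G.deleteVertex v).connectedComponentMk w = C} % m < m := by
  classical
  let cm := (G.deleteVertex v).connectedComponentMk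
  have hsame : ∀ x y : {w // w ≠ v}, p x = p y → p x ≠ p v → cm x = cm y := by
    intro x y hxy hxv
    rw [SimpleGraph.ConnectedComponent.eq]
    have h1 := hp (p x) ⟨x.1, rfl⟩ ⟨y.1, hxy.symm⟩
    let φ : G.induce {w | p w = p x} →g (G.deleteVertex v) :=
      { toFun := fun w => ⟨w.1, fun h => hxv (w.2.symm.trans (congrArg p h))⟩
        map_rel' := fun h => h }
    exact h1.map φ
  -- The exceptional component is the one containing block `i₀`, if that block is nonempty and
  -- avoids `v`; otherwise any component serves.
  obtain ⟨C₀, hC₀⟩ : ∃ C₀, ∀ x : {w // w ≠ v}, p x = i₀ → p x ≠ p v → cm x = C₀ := by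
    by_cases h : ∃ x : {w // w ≠ v}, p x = i₀ ∧ p x ≠ p v
    · obtain ⟨x, hx, hxv⟩ := h
      exact ⟨cm x, fun y hy hyv => hsame y x (hy.trans hx.symm) hyv⟩
    · push Not at h
      exact ⟨Classical.arbitrary _, fun x hx hxv => absurd (h x hx) hxv⟩
  refine ⟨C₀, ?_⟩
  let b : (G.deleteVertex v).ConnectedComponent → ℕ := fun C =>
    (Finset.univ.filter fun x : {w // w ≠ v} => p x = p v ∧ cm x = C).card
  have hmod : ∀ C ∈ Finset.univ.erase C₀, Nat.card {w // (G.deleteVertex v).connectedComponentMk w = C} % m ≤ b C := by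
    intro C hC
    have hC := Finset.ne_of_mem_erase hC
    -- Outside the block of `v`, such a `C` is a disjoint union of whole blocks of size `m`.
    have hdvd : m ∣ (Finset.univ.filter fun x : {w // w ≠ v} => p x ≠ p v ∧ cm x = C).card := by
      rw [Finset.card_eq_sum_card_image (fun x : {w // w ≠ v} => p x)]
      refine Finset.dvd_sum fun i hi => ?_
      obtain ⟨x, hx, rfl⟩ := Finset.mem_image.1 hi
      simp only [Finset.mem_filter, Finset.mem_univ, true_and] at hx
      have hi₀ : p x ≠ i₀ := fun h => hC (hx.2.symm.trans (hC₀ x h hx.1))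
      rw [← hm _ hi₀, Nat.card_eq_fintype_card, Fintype.card_subtype]
      refine dvd_of_eq (Finset.card_bij (fun w hw => ⟨w, ?_⟩) ?_ ?_ ?_)
      · rintro rfl
        exact hx.1 (Finset.mem_filter.1 hw).2.symm
      · intro w hw
        have hw := (Finset.mem_filter.1 hw).2
        simp only [Finset.mem_filter, Finset.mem_univ, true_and]
        exact ⟨⟨hw ▸ hx.1, (hsame x ⟨w, _⟩ hw.symm hx.1).symm.trans hx.2⟩, hw⟩
      · intro w _ w' _ h
        exact congrArg Subtype.val h
      · intro y hy
        simp only [Finset.mem_filter, Finset.mem_univ, true_and] at hy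
        exact ⟨y.1, by simpa using hy.2, rfl⟩
    have hsplit : Nat.card {w // (G.deleteVertex v).connectedComponentMk w = C} = b C +
        (Finset.univ.filter fun x : {w // w ≠ v} => p x ≠ p v ∧ cm x = C).card := by
      rw [Nat.card_eq_fintype_card, Fintype.card_subtype,
        ← Finset.card_filter_add_card_filter_not (fun x : {w // w ≠ v} => p x = p v),
        Finset.filter_filter, Finset.filter_filter]
      refine congrArg₂ (· + ·) (congrArg Finset.card ?_) (congrArg Finset.card ?_) <;>
      · ext x
        simp only [Finset.mem_filter, Finset.mem_univ, true_and]
        exact and_comm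
    obtain ⟨k, hk⟩ := hdvd
    rw [hsplit, hk, Nat.add_mul_mod_self_left]
    exact Nat.mod_le _ _
  have hb : ∑ C, b C < m := by
    have h1 : ∑ C, b C = (Finset.univ.filter fun x : {w // w ≠ v} => p x = p v).card := by
      rw [Finset.card_eq_sum_card_fiberwise (f := cm) (t := Finset.univ) (by simp)]
      simp only [b, Finset.filter_filter]
    have h2 : (Finset.univ.filter fun w : V => p w = p v).card ≤ m := by
      have h3 : Nat.card {w // p w = p v} ≤ m := by
        by_cases h : p v = i₀
        · rw [h]; exact hm₀
        · exact (hm _ h).le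
      rwa [Nat.card_eq_fintype_card, Fintype.card_subtype] at h3
    rw [h1]
    -- Strict because `v` belongs to its own block but to no component.
    refine lt_of_lt_of_le ?_ h2
    rw [← Finset.card_map (Function.Embedding.subtype _)]
    refine Finset.card_lt_card (Finset.ssubset_iff_subset_ne.2 ⟨?_, fun h => ?_⟩)
    · intro w hw
      simp only [Finset.mem_map, Finset.mem_filter, Finset.mem_univ, true_and] at hw ⊢
      obtain ⟨x, hx, rfl⟩ := hw
      exact hx
    · have : v ∈ (Finset.univ.filter fun w : V => p w = p v) := by simp
      rw [← h] at this
      simp only [Finset.mem_map, Finset.mem_filter, Finset.mem_univ, true_and] at this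
      obtain ⟨x, -, hx⟩ := this
      exact x.2 hx
  refine lt_of_le_of_lt (Finset.sum_le_sum hmod) (lt_of_le_of_lt ?_ hb)
  exact Finset.sum_le_sum_of_subset (Finset.erase_subset _ _)

/-- Distinct neighbours of `v` lie in distinct components: a path joining `u` to `w` off `v` would
give a second path from `v` to `w` besides the edge. -/
theorem SimpleGraph.IsTree.degree_le_card_connectedComponent {V : Type*} [Fintype V]
    (G : SimpleGraph V) [DecidableRel G.Adj] (hG : G.IsTree) (v : V) :
    G.degree v ≤ Nat.card (G.deleteVertex v).ConnectedComponent := by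
  classical
  rw [← SimpleGraph.card_neighborSet_eq_degree, ← Nat.card_eq_fintype_card]
  refine Nat.card_le_card_of_injective (fun w : G.neighborSet v =>
    (G.deleteVertex v).connectedComponentMk ⟨w.1, w.2.ne'⟩) ?_
  intro u w huw
  by_contra hne
  rw [SimpleGraph.ConnectedComponent.eq] at huw
  obtain ⟨P, hP⟩ := huw.exists_isPath
  let ι : G.deleteVertex v ↪g G := SimpleGraph.Embedding.induce _
  have hQ : (P.map ι.toHom).IsPath := hP.map ι.injective
  have hv : v ∉ (P.map ι.toHom).support := by
    rw [SimpleGraph.Walk.support_map, List.mem_map]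
    rintro ⟨x, -, hx⟩
    exact x.2 hx
  have hcons := hQ.cons hv (h := u.2)
  have huniq := (hG.isAcyclic.subsingleton_path v w).elim ⟨_, hcons⟩ (SimpleGraph.Path.singleton w.2)
  have hlen := congrArg (fun q : G.Path v w => q.1.length) huniq
  exact hne (Subtype.ext (SimpleGraph.Walk.eq_of_length_eq_zero (Nat.succ_injective hlen)))

theorem SimpleGraph.Connected.card_lt_of_isEPositive {V : Type*} [Fintype V] {G : SimpleGraph V}
    (hG : G.Connected) (he : G.IsEPositive) (v : V)
    (hd : 0 < Nat.card (G.deleteVertex v).ConnectedComponent) :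
    2 ^ (Nat.card (G.deleteVertex v).ConnectedComponent - 1) < Fintype.card V := by
  classical
  have : Fintype (G.deleteVertex v).ConnectedComponent := Fintype.ofFinite _
  have : Nonempty (G.deleteVertex v).ConnectedComponent := (Nat.card_pos_iff.1 hd).1
  obtain ⟨k, hk⟩ : ∃ k, Fintype.card V = k + 1 :=
    Nat.exists_eq_succ_of_ne_zero (Fintype.card_pos_iff.2 ⟨v⟩).ne'
  have h := two_pow_le_sum_of_residues
    (fun C => Nat.card {w // (G.deleteVertex v).connectedComponentMk w = C})
    (fun C => by
      obtain ⟨w, hw⟩ := C.exists_rep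
      exact Nat.card_pos_iff.2 ⟨⟨⟨w, hw⟩⟩, inferInstance⟩)
    (fun m hm => by
      obtain ⟨p, hp, hconn⟩ := hG.exists_connected_partition he
        -- Dividing `k = n - 1` rather than `n` gives the exceptional block a size between `1` and
        -- `m`, never `0`.
        (fun i : Option (Fin (k / m)) => i.elim (k % m + 1) fun _ => m)
        (by rintro (_ | i) <;> simp [hm.ne'])
        (by
          rw [Fintype.sum_option, hk]
          simp only [Option.elim, Finset.sum_const, Finset.card_univ, Fintype.card_fin,
            smul_eq_mul]
          have := Nat.mod_add_div k m
          rw [mul_comm] at this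
          omega)
      refine G.exists_sum_residues_lt v p m none ?_ ?_ hconn
      · rintro (_ | i) hi
        · exact absurd rfl hi
        · exact hp _
      · rw [hp]
        exact Nat.mod_lt _ hm)
    Finset.univ Finset.univ_nonempty
  rw [Finset.card_univ, ← Nat.card_eq_fintype_card] at h
  have hsum : ∑ C, Nat.card {w // (G.deleteVertex v).connectedComponentMk w = C} =
      Fintype.card {w // w ≠ v} := by
    simp only [Nat.card_eq_fintype_card]
    rw [← Fintype.card_sigma]
    exact Fintype.card_congr (Equiv.sigmaFiberEquiv _)
  rw [hsum, Fintype.card_subtype_compl, Fintype.card_subtype_eq, hk] at h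
  omega

theorem theorem4p1 {V : Type*} [Fintype V] (G : SimpleGraph V) [DecidableRel G.Adj]
    (n : ℕ) (hn : Fintype.card V = n) :
    (∀ (v : V) (d : ℕ), G.Connected → G.IsCutVertex v →
      Nat.card (G.deleteVertex v).ConnectedComponent = d → 3 ≤ d →
      Real.logb 2 (n : ℝ) + 1 ≤ (d : ℝ) → ¬ G.IsEPositive) ∧
    (∀ (v : V) (d : ℕ), G.IsTree → G.degree v = d → 3 ≤ d →
      Real.logb 2 (n : ℝ) + 1 ≤ (d : ℝ) → ¬ G.IsEPositive) := by
  have main : ∀ (v : V) (d : ℕ), G.Connected →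
      d ≤ Nat.card (G.deleteVertex v).ConnectedComponent → 3 ≤ d →
      Real.logb 2 (n : ℝ) + 1 ≤ (d : ℝ) → ¬ G.IsEPositive := by
    intro v d hG hd h3 hlog he
    have h1 := hG.card_lt_of_isEPositive he v (by omega)
    have h2 : 2 ^ (d - 1) < n := by
      rw [← hn]
      exact lt_of_le_of_lt (Nat.pow_le_pow_right two_pos (by omega)) h1
    have h4 : ((d - 1 : ℕ) : ℝ) < Real.logb 2 n := by
      rw [Real.lt_logb_iff_rpow_lt one_lt_two (by exact_mod_cast (Nat.zero_le _).trans_lt h2),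
        Real.rpow_natCast]
      exact_mod_cast h2
    rw [Nat.cast_sub (by omega)] at h4
    push_cast at h4
    linarith
  exact ⟨fun v d hG _ hd h3 hlog => main v d hG hd.ge h3 hlog,
    fun v d hT hd h3 hlog => main v d hT.connected
      (hd ▸ hT.degree_le_card_connectedComponent G v) h3 hlog⟩
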